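/- Fix $\alpha\in\{1,2,\dots\}$, real numbers $\epsilon,\gamma,\beta,\delta>0$ and $\theta\in\mathbb R$. For $N\ge 2$ let $\Lambda_N=\{1,\dots,N-1\}$ and $\Omega_N=\{0,\dots,\alpha\}^{\Lambda_N}$. Let $(\eta_t)_{t\ge0}$ be the càdlàg continuous-time Markov chain on $\Omega_N$ with the following transitions: for $x,y\in\Lambda_N$ with $|x-y|=1$, one particle moves from $x$ to $y$ at rate $\eta(x)[\alpha-\eta(y)]$; one particle is removed from site $1$ at rate $N^{-\theta}\gamma\,\eta(1)$ and one is added there at rate $N^{-\theta}\epsilon\,[\alpha-\eta(1)]$; one particle is removed from site $N-1$ at rate $N^{-\theta}\beta\,\eta(N-1)$ and one is added there at rate $N^{-\theta}\delta\,[\alpha-\eta(N-1)]$. For each $N$ let $\mu_N$ be an arbitrary probability measure on $\Omega_N$, and let $\mathbb E_{\mu_N}$ be the expectation for this chain started from $\mu_N$. Put $$\rho_-=\alpha\,\frac{\epsilon}{\epsilon+\gamma},\qquad \rho_+=\alpha\,\frac{\delta}{\delta+\beta}.$$ Let $T>0$. If $\theta<1$, then for every $t\in[0,T]$ $$\lim_{N\to\infty}\mathbb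 E_{\mu_N}\Big[\Big|\int_0^t\big(\rho_--\eta_{sN^2}(1)\big)\,ds\Big|\Big]=0 \qquad\text{and}\qquad \lim_{N\to\infty}\mathbb E_{\mu_N}\Big[\Big|\int_0^t\big(\rho_+-\eta_{sN^2}(N-1)\big)\,ds\Big|\Big]=0.$$ -/

import Mathlib

open MeasureTheory Filter Topology

/-! The generalized symmetric exclusion process SEP(`α`) on `{1, …, N - 1}` with reservoirs. -/

namespace SEP

/-- Parameters of the model: at most `α` particles per site; `ε`, `γ` are the injection and
absorption rates of the left reservoir, `δ`, `β` those of the right one; both reservoirs act with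
strength `1 / N ^ θ`. -/
structure Params where
  α : ℕ
  ε : ℝ
  γ : ℝ
  β : ℝ
  δ : ℝ
  θ : ℝ

/-- The bulk `{1, …, N - 1}`. -/
abbrev Site (N : ℕ) : Type := {x : ℕ // x ∈ Finset.Icc 1 (N - 1)}

/-- Configurations: `{0, …, α}` to the power `{1, …, N - 1}`. -/
abbrev Config (α N : ℕ) : Type := Site N → Fin (α + 1)

/-- The number `η(x)` of particles at the site `x` (zero if `x` is not a site of the bulk). -/
def occ {α N : ℕ} (η : Config α N) (x : ℕ) : ℝ :=
  if h : x ∈ Finset.Icc 1 (N - 1) then ((η ⟨x, h⟩ : ℕ) : ℝ) else 0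

/-- One particle is removed from `x`; nothing changes if `x` is empty. -/
def removeAt {α N : ℕ} (η : Config α N) (x : ℕ) : Config α N := fun z =>
  if (z : ℕ) = x then ⟨(η z : ℕ) - 1, by have := (η z).isLt; omega⟩ else η z

/-- One particle is added at `x`; nothing changes if `x` already holds `α` particles. -/
def addAt {α N : ℕ} (η : Config α N) (x : ℕ) : Config α N := fun z =>
  if (z : ℕ) = x then ⟨min ((η z : ℕ) + 1) α, by omega⟩ else η z

/-- The configuration `η^{x,y}`, in which one particle has moved from `x` to `y ≠ x`. It is used
only with the factor `η(x) (α - η(y))`, which is zero if `x` is empty or `y` is full. -/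
def move {α N : ℕ} (η : Config α N) (x y : ℕ) : Config α N := addAt (removeAt η x) y

/-- The bulk rate `c_{x,y}(η) = η(x) (α - η(y))`. -/
def bulkRate {α N : ℕ} (η : Config α N) (x y : ℕ) : ℝ := occ η x * ((α : ℝ) - occ η y)

/-- The left boundary part of the generator. -/
noncomputable def genLeft (p : Params) {N : ℕ} (f : Config p.α N → ℝ) (η : Config p.α N) : ℝ :=
  1 / (N : ℝ) ^ p.θ * (p.γ * occ η 1) * (f (removeAt η 1) - f η)
    + 1 / (N : ℝ) ^ p.θ * (p.ε * ((p.α : ℝ) - occ η 1)) * (f (addAt η 1) - f η)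

/-- The bulk part of the generator. -/
noncomputable def genBulk (p : Params) {N : ℕ} (f : Config p.α N → ℝ) (η : Config p.α N) : ℝ :=
  ∑ x ∈ Finset.Icc 1 (N - 2),
    (bulkRate η x (x + 1) * (f (move η x (x + 1)) - f η)
      + bulkRate η (x + 1) x * (f (move η (x + 1) x) - f η))

/-- The right boundary part of the generator. -/
noncomputable def genRight (p : Params) {N : ℕ} (f : Config p.α N → ℝ) (η : Config p.α N) : ℝ :=
  1 / (N : ℝ) ^ p.θ * (p.β * occ η (N - 1)) * (f (removeAt η (N - 1)) - f η)
    + 1 / (N : ℝ) ^ p.θ * (p.δ * ((p.α : ℝ) - occ η (N - 1))) * (f (addAt η (N - 1)) - f η)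

/-- The generator of SEP(`α`), without acceleration of time. -/
noncomputable def gen (p : Params) (N : ℕ) (f : Config p.α N → ℝ) (η : Config p.α N) : ℝ :=
  genLeft p f η + genBulk p f η + genRight p f η

/-- The generator as a matrix indexed by configurations (its `Q`-matrix). -/
noncomputable def genMatrix (p : Params) (N : ℕ) : Matrix (Config p.α N) (Config p.α N) ℝ :=
  Matrix.of fun η ξ => gen p N (Pi.single ξ 1) η

/-- The matrix acts on functions as the generator. -/
theorem genMatrix_mulVec (p : Params) (N : ℕ) (f : Config p.α N → ℝ) :
    (genMatrix p N).mulVec f = gen p N f := by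
  have key : ∀ η : Config p.α N, f η = ∑ ξ, (Pi.single ξ (1 : ℝ) : Config p.α N → ℝ) η * f ξ := by
    intro η
    simp [Pi.single_apply]
  funext η
  simp only [Matrix.mulVec, dotProduct, genMatrix, Matrix.of_apply, gen, genLeft, genBulk, genRight,
    add_mul, Finset.sum_add_distrib, Finset.sum_mul]
  rw [Finset.sum_comm, Finset.sum_comm (t := Finset.Icc 1 (N - 2))]
  simp only [mul_assoc, sub_mul, ← Finset.mul_sum, Finset.sum_sub_distrib, ← key]

/-- `X`, observed at times `t ≥ 0`, is a realization on the probability space `(Ω, P)` of the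
continuous-time Markov chain on the finite set `S` with generator matrix `Q` and initial law `μ`:
its paths are càdlàg (for the discrete topology of `S`), and its finite-dimensional distributions
are given by `μ` and by the transition matrices `exp (t Q)`. -/
structure IsMarkovChain {S Ω : Type*} [Fintype S] [DecidableEq S] [MeasurableSpace Ω]
    (P : Measure Ω) (Q : Matrix S S ℝ) (μ : PMF S) (X : ℝ → Ω → S) : Prop where
  measurableSet_eq : ∀ t, 0 ≤ t → ∀ x, MeasurableSet {ω | X t ω = x}
  right_continuous : ∀ ω t, 0 ≤ t → ∀ᶠ s in 𝓝[>] t, X s ω = X t ω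
  left_limits : ∀ ω t, 0 < t → ∃ x, ∀ᶠ s in 𝓝[<] t, X s ω = x
  law : ∀ (n : ℕ) (t : ℕ → ℝ) (x : ℕ → S), t 0 = 0 → Monotone t →
    P.real {ω | ∀ i ≤ n, X (t i) ω = x i} =
      (μ (x 0)).toReal *
        ∏ i ∈ Finset.range n, NormedSpace.exp ((t (i + 1) - t i) • Q) (x i) (x (i + 1))

/-- The density `ρ₋ = α ε / (ε + γ)` of the left reservoir. -/
noncomputable def rhoLeft (p : Params) : ℝ := p.α * (p.ε / (p.ε + p.γ))

/-- The density `ρ₊ = α δ / (δ + β)` of the right reservoir. -/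
noncomputable def rhoRight (p : Params) : ℝ := p.α * (p.δ / (p.δ + p.β))

end SEP

namespace SEP

/-! ### Finite-state Markov chains: joint measurability, two-time laws, Dynkin's formula. -/

section MarkovChain

variable {S Ω : Type*} [Fintype S] [DecidableEq S] [MeasurableSpace Ω]
  {P : Measure Ω} {Q : Matrix S S ℝ} {μ : PMF S} {X : ℝ → Ω → S}

-- The generator is applied to `lin a`, with `a` affine of slope ±1 and zero at the opposite end of
-- the bulk. Bulk currents are gradients, so they telescope to a bounded term. The far reservoir
-- drops out, and the near one contributes `K (ρ - η)`, where `K` is of order `N ^ (1 - θ)` and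
-- tends to infinity because `θ < 1` (`gen_lin`).
--
-- It remains to see that time integrals of `Q f` are small. The mean square of `∫ Q f` over `[0,
-- t]` is twice an integral over ordered times `s < u`. Dynkin's formula integrates out `u` and
-- leaves increments of `f`, whence the bound `4 t ‖Q f‖ ‖f‖` (`integral_sq_integral_generator_le`).
-- Here `‖f‖` is at most `α N ^ 2`, which the acceleration of time compensates exactly, and `‖Q f‖`
-- is `O(1 + K)`. Dividing by `K` leaves an error of order `K ^ (-1/2)`, whatever the initial law:
-- neither entropy nor an invariant measure enters.

attribute [local instance] Matrix.linftyOpNormedRing Matrix.linftyOpNormedAlgebra in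
theorem hasDerivAt_exp_smul_mulVec (Q : Matrix S S ℝ) (f : S → ℝ) (x : S) (t : ℝ) :
    HasDerivAt (fun u : ℝ => (NormedSpace.exp (u • Q)).mulVec f x)
      ((NormedSpace.exp (t • Q)).mulVec (Q.mulVec f) x) t := by
  have h := hasDerivAt_exp_smul_const (𝕂 := ℝ) Q t
  let l : Matrix S S ℝ →ₗ[ℝ] ℝ :=
    { toFun := fun A => A.mulVec f x
      map_add' := fun A B => by simp [Matrix.add_mulVec]
      map_smul' := fun c A => by simp [Matrix.smul_mulVec] }
  have h2 := (LinearMap.toContinuousLinearMap l).hasFDerivAt.comp_hasDerivAt t h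
  exact h2.congr_deriv (congrFun (Matrix.mulVec_mulVec f _ _).symm x)

omit [MeasurableSpace Ω] in
theorem comp_eq_sum_indicator (g : S → ℝ) (Y : Ω → S) (ω : Ω) :
    g (Y ω) = ∑ x, g x * Set.indicator {ω | Y ω = x} (fun _ => (1 : ℝ)) ω := by
  simp [Set.indicator_apply]

theorem IsMarkovChain.measurable_comp (hX : IsMarkovChain P Q μ X) (g : S → ℝ) {t : ℝ}
    (ht : 0 ≤ t) : Measurable fun ω => g (X t ω) := by
  simp_rw [comp_eq_sum_indicator g (X t)]
  exact Finset.measurable_sum _ fun x _ =>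
    (measurable_const.indicator (hX.measurableSet_eq t ht x)).const_mul _

theorem IsMarkovChain.measurable_uncurry (hX : IsMarkovChain P Q μ X) (g : S → ℝ) :
    Measurable fun z : ℝ × Ω => g (X (max z.1 0) z.2) := by
  have hpos : ∀ n k : ℕ, (0 : ℝ) ≤ ((k : ℝ) + 1) / (n + 1) := fun n k => by positivity
  -- Time is rounded to a grid point strictly to its right, at distance at most `1 / (n + 1)`, so
  -- that right continuity gives convergence. Each approximation involves only countably many times.
  -- The `max` keeps times in the range where the chain is specified.
  refine measurable_of_tendsto_metrizable
    (f := fun (n : ℕ) (z : ℝ × Ω) =>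
      g (X (((⌊((n : ℝ) + 1) * max z.1 0⌋₊ : ℝ) + 1) / (n + 1)) z.2)) (fun n => ?_) ?_
  · have h1 : Measurable fun w : ℕ × Ω => g (X (((w.1 : ℝ) + 1) / (n + 1)) w.2) :=
      measurable_from_prod_countable_right fun k => hX.measurable_comp g (hpos n k)
    have h2 : Measurable fun z : ℝ × Ω => (⌊((n : ℝ) + 1) * max z.1 0⌋₊, z.2) := by
      refine Measurable.prodMk (Nat.measurable_floor.comp ?_) measurable_snd
      fun_prop
    exact h1.comp h2
  · rw [tendsto_pi_nhds]
    rintro ⟨s, ω⟩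
    set r : ℝ := max s 0 with hr
    have hr0 : 0 ≤ r := le_max_right _ _
    have hlim : Tendsto (fun n : ℕ => ((⌊((n : ℝ) + 1) * r⌋₊ : ℝ) + 1) / (n + 1)) atTop
        (𝓝[>] r) := by
      refine tendsto_nhdsWithin_iff.2 ⟨?_, Eventually.of_forall fun n => ?_⟩
      · have h0 : Tendsto (fun n : ℕ => r + 1 / ((n : ℝ) + 1)) atTop (𝓝 r) := by
          simpa using tendsto_const_nhds.add (tendsto_one_div_add_atTop_nhds_zero_nat (𝕜 := ℝ))
        refine tendsto_of_tendsto_of_tendsto_of_le_of_le tendsto_const_nhds h0 (fun n => ?_)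
          fun n => ?_
        · have hn : (0 : ℝ) < n + 1 := by positivity
          have := Nat.lt_floor_add_one (((n : ℝ) + 1) * r)
          rw [le_div_iff₀ hn]
          linarith
        · have hn : (0 : ℝ) < n + 1 := by positivity
          have := Nat.floor_le (mul_nonneg hn.le hr0)
          change _ / _ ≤ r + 1 / ((n : ℝ) + 1)
          rw [div_le_iff₀ hn, add_mul r, one_div, inv_mul_cancel₀ hn.ne']
          linarith
      · have hn : (0 : ℝ) < n + 1 := by positivity
        have := Nat.lt_floor_add_one (((n : ℝ) + 1) * r)
        rw [Set.mem_Ioi, lt_div_iff₀ hn]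
        linarith
    refine tendsto_const_nhds.congr' ?_
    filter_upwards [hlim.eventually (hX.right_continuous ω r hr0)] with n hn
    rw [← hn]

theorem IsMarkovChain.real_eq_and_eq [IsProbabilityMeasure P] (hX : IsMarkovChain P Q μ X)
    {s u : ℝ} (hs : 0 ≤ s) (hsu : s ≤ u) (x y : S) :
    P.real {ω | X s ω = x ∧ X u ω = y} =
      P.real {ω | X s ω = x} * NormedSpace.exp ((u - s) • Q) x y := by
  -- The finite-dimensional laws always include time 0, so the initial state is summed out.
  have hsum : ∀ A : Set Ω, MeasurableSet A →
      P.real A = ∑ z, P.real ({ω | X 0 ω = z} ∩ A) := by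
    intro A hA
    rw [← measureReal_biUnion_finset]
    · congr 1
      ext ω
      simp
    · intro a _ b _ hab
      refine Set.disjoint_left.2 fun ω h1 h2 => hab ?_
      exact h1.1.symm.trans h2.1
    · exact fun z _ => (hX.measurableSet_eq 0 le_rfl z).inter hA
  have hms := hX.measurableSet_eq s hs x
  have hmu := hX.measurableSet_eq u (hs.trans hsu) y
  rw [hsum _ hms, Set.ofPred_and, hsum _ (hms.inter hmu), Finset.sum_mul]
  refine Finset.sum_congr rfl fun z _ => ?_
  let τ : ℕ → ℝ := fun i => if i = 0 then 0 else if i = 1 then s else u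
  have hτ : Monotone τ := by
    refine monotone_nat_of_le_succ fun n => ?_
    rcases n with _ | _ | n <;> simp [τ, hs, hsu]
  let w : ℕ → S := fun i => if i = 0 then z else if i = 1 then x else y
  have h1 := hX.law 1 τ w rfl hτ
  have h2 := hX.law 2 τ w rfl hτ
  have e1 : {ω | ∀ i ≤ 1, X (τ i) ω = w i} = {ω | X 0 ω = z} ∩ {ω | X s ω = x} := by
    ext ω
    simp [Nat.le_one_iff_eq_zero_or_eq_one, τ, w]
  have e2 : {ω | ∀ i ≤ 2, X (τ i) ω = w i} =
      {ω | X 0 ω = z} ∩ ({ω | X s ω = x} ∩ {ω | X u ω = y}) := by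
    ext ω
    constructor
    · intro h
      exact ⟨h 0 (by simp), h 1 (by simp), h 2 (by simp)⟩
    · rintro ⟨a, b, c⟩ i hi
      interval_cases i
      exacts [a, b, c]
  rw [e1] at h1
  rw [e2, Finset.prod_range_succ, ← mul_assoc, ← h1] at h2
  exact h2

theorem IsMarkovChain.integral_mul_comp [IsProbabilityMeasure P] (hX : IsMarkovChain P Q μ X)
    (g f : S → ℝ) {s u : ℝ} (hs : 0 ≤ s) (hsu : s ≤ u) :
    ∫ ω, g (X s ω) * f (X u ω) ∂P =
      ∑ x, P.real {ω | X s ω = x} * g x * (NormedSpace.exp ((u - s) • Q)).mulVec f x := by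
  have hm : ∀ x y, MeasurableSet {ω | X s ω = x ∧ X u ω = y} := fun x y =>
    (hX.measurableSet_eq s hs x).inter (hX.measurableSet_eq u (hs.trans hsu) y)
  have h : ∀ ω, g (X s ω) * f (X u ω) = ∑ x, ∑ y,
      (g x * f y) * Set.indicator {ω | X s ω = x ∧ X u ω = y} (fun _ => (1 : ℝ)) ω := by
    intro ω
    simp only [Set.indicator_apply, Set.mem_ofPred_eq, mul_ite, mul_one, mul_zero, ite_and]
    rw [Finset.sum_eq_single (X s ω)] <;> simp +contextual [eq_comm]
  have hi : ∀ x y, Integrable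
      (fun ω => (g x * f y) * Set.indicator {ω | X s ω = x ∧ X u ω = y} (fun _ => (1 : ℝ)) ω) P :=
    fun x y => ((integrable_const 1).indicator (hm x y)).const_mul _
  simp_rw [h]
  rw [integral_finsetSum _ fun x _ => integrable_finsetSum _ fun y _ => hi x y]
  refine Finset.sum_congr rfl fun x _ => ?_
  rw [integral_finsetSum _ fun y _ => hi x y, Matrix.mulVec, dotProduct, Finset.mul_sum]
  refine Finset.sum_congr rfl fun y _ => ?_
  rw [integral_const_mul, integral_indicator_const _ (hm x y), hX.real_eq_and_eq hs hsu]
  simp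
  ring

/-- Dynkin's formula tested against the state at time `s`: by the Markov property, `E[g(X_s)
f(X_u)]` has `u`-derivative `E[g(X_s) Q f(X_u)]`. -/
theorem IsMarkovChain.integral_integral_mul_generator [IsProbabilityMeasure P]
    (hX : IsMarkovChain P Q μ X) (g f : S → ℝ) {s t : ℝ} (hs : 0 ≤ s) (hst : s ≤ t) :
    ∫ u in s..t, ∫ ω, g (X s ω) * Q.mulVec f (X u ω) ∂P =
      ∫ ω, g (X s ω) * f (X t ω) ∂P - ∫ ω, g (X s ω) * f (X s ω) ∂P := by
  have hder : ∀ f : S → ℝ, ∀ u, HasDerivAt (fun u => ∑ x, P.real {ω | X s ω = x} * g x *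
      (NormedSpace.exp ((u - s) • Q)).mulVec f x) (∑ x, P.real {ω | X s ω = x} * g x *
      (NormedSpace.exp ((u - s) • Q)).mulVec (Q.mulVec f) x) u := fun f u =>
    HasDerivAt.fun_sum fun x _ =>
      ((hasDerivAt_exp_smul_mulVec Q f x (u - s)).comp_sub_const u s).const_mul _
  have hcont : Continuous fun u => ∑ x, P.real {ω | X s ω = x} * g x *
      (NormedSpace.exp ((u - s) • Q)).mulVec (Q.mulVec f) x :=
    continuous_iff_continuousAt.2 fun u => (hder (Q.mulVec f) u).continuousAt
  rw [hX.integral_mul_comp g f hs hst, hX.integral_mul_comp g f hs le_rfl,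
    ← intervalIntegral.integral_eq_sub_of_hasDerivAt (fun u _ => hder f u)
      (hcont.intervalIntegrable _ _)]
  refine intervalIntegral.integral_congr fun u hu => ?_
  rw [Set.uIcc_of_le hst] at hu
  exact hX.integral_mul_comp g (Q.mulVec f) hs hu.1

end MarkovChain

/-! ### Mean-square bounds for time integrals along the chain. -/

/-- The square of the integral of a right-continuous function, as an integral over ordered pairs. -/
theorem sq_integral_eq {h : ℝ → ℝ} {t : ℝ} (ht : 0 ≤ t)
    (hint : ∀ a b, IntervalIntegrable h volume a b) (hm : Measurable h)
    (hc : ∀ s ∈ Set.Ioo 0 t, ContinuousWithinAt h (Set.Ioi s) s) :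
    (∫ s in (0 : ℝ)..t, h s) ^ 2 = 2 * ∫ s in (0 : ℝ)..t, h s * ∫ u in s..t, h u := by
  have hF : Continuous fun s => ∫ u in s..t, h u := by
    simp_rw [fun s => intervalIntegral.integral_symm (f := h) (μ := volume) t s]
    exact (intervalIntegral.continuous_primitive hint t).neg
  -- Right continuity of `h` yields only a right derivative, which suffices for the fundamental
  -- theorem of calculus.
  have hd : ∀ s ∈ Set.Ioo (min 0 t) (max 0 t), HasDerivWithinAt (fun s => (∫ u in s..t, h u) ^ 2)
      (-2 * (h s * ∫ u in s..t, h u)) (Set.Ioi s) s := by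
    intro s hs
    rw [min_eq_left ht, max_eq_right ht] at hs
    have h1 : HasDerivWithinAt (fun s => ∫ u in s..t, h u) (-h s) (Set.Ici s) s :=
      intervalIntegral.integral_hasDerivWithinAt_left (hint s t)
        hm.stronglyMeasurable.stronglyMeasurableAtFilter (hc s hs)
    exact ((h1.mono Set.Ioi_subset_Ici_self).pow 2).congr_deriv (by simp; ring)
  have h2 := intervalIntegral.integral_eq_sub_of_hasDeriv_right
    ((hF.pow 2).continuousOn) hd (((hint 0 t).mul_continuousOn hF.continuousOn).const_mul _)
  rw [intervalIntegral.integral_const_mul] at h2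
  simp at h2
  linarith

theorem abs_integral_le_of_abs_le {Ω : Type*} [MeasurableSpace Ω] {P : Measure Ω}
    [IsProbabilityMeasure P] {f : Ω → ℝ} {C : ℝ} (h : ∀ ω, |f ω| ≤ C) : |∫ ω, f ω ∂P| ≤ C := by
  simpa using norm_integral_le_of_norm_le_const (μ := P) (f := f) (C := C) (Eventually.of_forall h)

variable {S Ω : Type*} [Fintype S] [DecidableEq S] [MeasurableSpace Ω]
  {P : Measure Ω} {Q : Matrix S S ℝ} {μ : PMF S} {X : ℝ → Ω → S}

omit [DecidableEq S] in
theorem exists_abs_le (g : S → ℝ) : ∃ C, 0 ≤ C ∧ ∀ x, |g x| ≤ C :=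
  ⟨∑ x, |g x|, Finset.sum_nonneg fun _ _ => abs_nonneg _, fun x =>
    Finset.single_le_sum (f := fun x => |g x|) (fun _ _ => abs_nonneg _) (Finset.mem_univ x)⟩

theorem IsMarkovChain.intervalIntegrable (hX : IsMarkovChain P Q μ X) (g : S → ℝ) (ω : Ω)
    (a b : ℝ) : IntervalIntegrable (fun s => g (X (max s 0) ω)) volume a b := by
  obtain ⟨C, -, hC⟩ := exists_abs_le g
  refine intervalIntegrable_const (c := C) |>.mono_fun
    ((hX.measurable_uncurry g).comp measurable_prodMk_right).aestronglyMeasurable ?_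
  exact Eventually.of_forall fun s => (hC _).trans (le_abs_self C)

theorem IsMarkovChain.measurable_integral (hX : IsMarkovChain P Q μ X) (g : S → ℝ) (a b : ℝ) :
    Measurable fun ω => ∫ s in a..b, g (X (max s 0) ω) := by
  have h := ((hX.measurable_uncurry g).comp measurable_swap).stronglyMeasurable
  simp only [intervalIntegral]
  exact (StronglyMeasurable.integral_prod_right (f := fun ω s => g (X (max s 0) ω)) h).measurable.sub
    (StronglyMeasurable.integral_prod_right (f := fun ω s => g (X (max s 0) ω)) h).measurable

theorem IsMarkovChain.measurable_uncurry_integral (hX : IsMarkovChain P Q μ X) (g : S → ℝ)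
    (t : ℝ) : Measurable fun z : ℝ × Ω => ∫ u in z.1..t, g (X (max u 0) z.2) := by
  have hm : Measurable fun w : (ℝ × Ω) × ℝ => g (X (max w.2 0) w.1.2) :=
    (hX.measurable_uncurry g).comp (measurable_snd.prodMk (measurable_snd.comp measurable_fst))
  have key : ∀ A : Set ((ℝ × Ω) × ℝ), MeasurableSet A →
      Measurable fun z : ℝ × Ω => ∫ u, A.indicator (fun w => g (X (max w.2 0) w.1.2)) (z, u) :=
    fun A hA => (StronglyMeasurable.integral_prod_right
      (f := fun z u => A.indicator (fun w => g (X (max w.2 0) w.1.2)) (z, u))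
      (hm.indicator hA).stronglyMeasurable).measurable
  have hs : Measurable fun w : (ℝ × Ω) × ℝ => w.1.1 := measurable_fst.comp measurable_fst
  have h1 := key ({w | w.1.1 < w.2} ∩ {w | w.2 ≤ t})
    ((measurableSet_lt hs measurable_snd).inter (measurableSet_le measurable_snd measurable_const))
  have h2 := key ({w | t < w.2} ∩ {w | w.2 ≤ w.1.1})
    ((measurableSet_lt measurable_const measurable_snd).inter (measurableSet_le measurable_snd hs))
  -- An interval integral with a moving endpoint is a difference of two integrals over the whole
  -- line, with the endpoint inside the indicators.
  convert h1.sub h2 using 1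
  funext z
  simp only [Pi.sub_apply, intervalIntegral, ← integral_indicator measurableSet_Ioc]
  rfl

theorem IsMarkovChain.continuousWithinAt (hX : IsMarkovChain P Q μ X) (g : S → ℝ) (ω : Ω) {s : ℝ}
    (hs : 0 ≤ s) : ContinuousWithinAt (fun s => g (X (max s 0) ω)) (Set.Ioi s) s := by
  refine tendsto_const_nhds.congr' ?_
  filter_upwards [hX.right_continuous ω s hs, self_mem_nhdsWithin] with u hu hsu
  rw [max_eq_left hs, max_eq_left (hs.trans (le_of_lt hsu)), hu]

/-- The time integral of `Q f` along the chain is small in mean square. -/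
theorem IsMarkovChain.integral_sq_integral_generator_le [IsProbabilityMeasure P]
    (hX : IsMarkovChain P Q μ X) {f : S → ℝ} {V F t : ℝ} (hV : ∀ x, |Q.mulVec f x| ≤ V)
    (hF : ∀ x, |f x| ≤ F) (ht : 0 ≤ t) :
    ∫ ω, (∫ s in (0 : ℝ)..t, Q.mulVec f (X (max s 0) ω)) ^ 2 ∂P ≤ 4 * t * (V * F) := by
  set g := Q.mulVec f with hg
  have hjm := hX.measurable_uncurry g
  have hprod : ∀ x y, |g x * g y| ≤ V * V := fun x y => by
    rw [abs_mul]
    exact mul_le_mul (hV _) (hV _) (abs_nonneg _) ((abs_nonneg _).trans (hV x))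
  have hprodF : ∀ x y, |g x * f y| ≤ V * F := fun x y => by
    rw [abs_mul]
    exact mul_le_mul (hV _) (hF _) (abs_nonneg _) ((abs_nonneg _).trans (hV x))
  have hsq : ∀ ω, (∫ s in (0 : ℝ)..t, g (X (max s 0) ω)) ^ 2 = 2 * ∫ s in (0 : ℝ)..t,
      g (X (max s 0) ω) * ∫ u in s..t, g (X (max u 0) ω) := fun ω =>
    sq_integral_eq ht (hX.intervalIntegrable g ω) (hjm.comp measurable_prodMk_right)
      fun s hs => hX.continuousWithinAt g ω hs.1.le
  -- After Fubini, Dynkin's formula replaces the integral over `u` by two boundary terms, each at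
  -- most `V * F`. With the factor 2 from ordering the times, this gives the constant 4.
  have hinner : ∀ s ∈ Set.Icc 0 t,
      |∫ ω, g (X (max s 0) ω) * (∫ u in s..t, g (X (max u 0) ω)) ∂P| ≤ 2 * (V * F) := by
    intro s hs
    simp_rw [← intervalIntegral.integral_const_mul]
    rw [← intervalIntegral_integral_swap]
    · have : ∫ u in s..t, ∫ ω, g (X (max s 0) ω) * g (X (max u 0) ω) ∂P =
          ∫ u in s..t, ∫ ω, g (X s ω) * Q.mulVec f (X u ω) ∂P := by
        refine intervalIntegral.integral_congr fun u hu => ?_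
        rw [Set.uIcc_of_le hs.2] at hu
        simp only [max_eq_left hs.1, max_eq_left (hs.1.trans hu.1), hg]
      rw [this, hX.integral_integral_mul_generator g f hs.1 hs.2]
      refine (abs_sub _ _).trans ?_
      have h1 := abs_integral_le_of_abs_le (P := P) fun ω => hprodF (X s ω) (X t ω)
      have h2 := abs_integral_le_of_abs_le (P := P) fun ω => hprodF (X s ω) (X s ω)
      linarith
    · have : IsFiniteMeasure (volume.restrict (Set.uIoc s t)) := ⟨by simp [Set.uIoc]⟩
      refine Integrable.of_bound (C := V * V) (Measurable.aestronglyMeasurable ?_)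
        (Eventually.of_forall fun z => hprod _ _)
      exact (hjm.comp (measurable_const.prodMk measurable_snd)).mul hjm
  rw [integral_congr_ae (Eventually.of_forall hsq)]
  rw [integral_const_mul, ← intervalIntegral_integral_swap]
  · have h := intervalIntegral.norm_integral_le_of_norm_le_const (a := 0) (b := t)
      (C := 2 * (V * F))
      (f := fun s => ∫ ω, g (X (max s 0) ω) * (∫ u in s..t, g (X (max u 0) ω)) ∂P) fun s hs => by
        rw [Set.uIoc_of_le ht] at hs
        exact hinner s ⟨hs.1.le, hs.2⟩
    rw [sub_zero, abs_of_nonneg ht] at h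
    have := (le_abs_self _).trans h
    linarith
  · have : IsFiniteMeasure (volume.restrict (Set.uIoc 0 t)) := ⟨by simp [Set.uIoc]⟩
    refine Integrable.of_bound (C := V * (V * t))
      (hjm.mul (hX.measurable_uncurry_integral g t)).aestronglyMeasurable ?_
    have hae : ∀ᵐ s ∂volume.restrict (Set.uIoc 0 t), s ∈ Set.uIoc 0 t :=
      ae_restrict_mem measurableSet_uIoc
    filter_upwards [Measure.quasiMeasurePreserving_fst.ae hae] with z hz
    rw [Set.uIoc_of_le ht] at hz
    have h := intervalIntegral.norm_integral_le_of_norm_le_const (a := z.1) (b := t)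
      (f := fun u => g (X (max u 0) z.2)) (C := V) fun u _ => hV _
    have hV0 : 0 ≤ V := (abs_nonneg _).trans (hV (X 0 z.2))
    rw [Function.uncurry, norm_mul]
    refine mul_le_mul (hV _) (h.trans ?_) (norm_nonneg _) hV0
    rw [abs_of_nonneg (by linarith [hz.2])]
    exact mul_le_mul_of_nonneg_left (by linarith [hz.1]) hV0

theorem integral_abs_le_sqrt [IsProbabilityMeasure P] {Y : Ω → ℝ} {C B : ℝ} (hm : Measurable Y)
    (hB : ∀ ω, |Y ω| ≤ B) (h : ∫ ω, Y ω ^ 2 ∂P ≤ C) : ∫ ω, |Y ω| ∂P ≤ √C := by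
  have hL : MemLp (fun ω => |Y ω|) 2 P :=
    MemLp.of_bound hm.abs.aestronglyMeasurable B (Eventually.of_forall fun ω => by simpa using hB ω)
  -- Nonnegativity of the variance of `|Y|` is the Cauchy–Schwarz inequality needed here.
  have h0 := ProbabilityTheory.variance_nonneg (fun ω => |Y ω|) P
  rw [ProbabilityTheory.variance_eq_sub hL] at h0
  simp only [Pi.pow_apply, sq_abs] at h0
  exact Real.le_sqrt_of_sq_le (by linarith)

/-- If `K h` is the image under the generator of a bounded function up to a bounded error, then the
time integral of `h` along the accelerated chain is of order `1 / √K + 1 / K`. -/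
theorem IsMarkovChain.integral_abs_integral_le [IsProbabilityMeasure P]
    (hX : IsMarkovChain P Q μ X) {f r h : S → ℝ} {K R H F M t : ℝ} (hK : 0 < K) (hM : 0 < M)
    (ht : 0 ≤ t) (hQ : ∀ x, Q.mulVec f x = r x + K * h x) (hr : ∀ x, |r x| ≤ R)
    (hh : ∀ x, |h x| ≤ H) (hF : ∀ x, |f x| ≤ F) :
    ∫ ω, |∫ s in (0 : ℝ)..t, h (X (s * M) ω)| ∂P ≤
      (√(4 * t * (R + K * H) * (F / M)) + R * t) / K := by
  have hV : ∀ x, |Q.mulVec f x| ≤ R + K * H := fun x => by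
    rw [hQ]
    refine (abs_add_le _ _).trans (add_le_add (hr x) ?_)
    rw [abs_mul, abs_of_pos hK]
    exact mul_le_mul_of_nonneg_left (hh x) hK.le
  have hscale : ∀ (g : S → ℝ) ω, ∫ s in (0 : ℝ)..t, g (X (s * M) ω) =
      M⁻¹ * ∫ s in (0 : ℝ)..(t * M), g (X (max s 0) ω) := fun g ω => by
    have := intervalIntegral.integral_comp_mul_right (a := 0) (b := t)
      (fun s => g (X (max s 0) ω)) hM.ne'
    rw [zero_mul, smul_eq_mul] at this
    rw [← this]
    refine intervalIntegral.integral_congr fun s hs => ?_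
    rw [Set.uIcc_of_le ht] at hs
    simp only [max_eq_left (mul_nonneg hs.1 hM.le)]
  have hmeas : ∀ g : S → ℝ, Measurable fun ω => ∫ s in (0 : ℝ)..t, g (X (s * M) ω) := fun g => by
    simp_rw [hscale]
    exact (hX.measurable_integral g _ _).const_mul _
  have hbound : ∀ (g : S → ℝ) (C : ℝ), (∀ x, |g x| ≤ C) →
      ∀ ω, |∫ s in (0 : ℝ)..t, g (X (s * M) ω)| ≤ C * t := fun g C hC ω => by
    simpa [abs_of_nonneg ht] using intervalIntegral.norm_integral_le_of_norm_le_const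
      (a := 0) (b := t) (f := fun s => g (X (s * M) ω)) (C := C) fun s _ => hC _
  have hsq : ∫ ω, (∫ s in (0 : ℝ)..t, Q.mulVec f (X (s * M) ω)) ^ 2 ∂P ≤
      4 * t * (R + K * H) * (F / M) := by
    simp_rw [hscale, mul_pow]
    rw [integral_const_mul]
    -- The change of time gives `M⁻¹ ^ 2`, while the horizon becomes `t * M`; one factor `1 / M`
    -- survives and goes with `F`.
    refine (mul_le_mul_of_nonneg_left (hX.integral_sq_integral_generator_le hV hF
      (mul_nonneg ht hM.le)) (by positivity)).trans (le_of_eq ?_)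
    field_simp
  have h1 := integral_abs_le_sqrt (hmeas _) (hbound _ _ hV) hsq
  have hpt : ∀ ω, |∫ s in (0 : ℝ)..t, h (X (s * M) ω)| ≤
      (|∫ s in (0 : ℝ)..t, Q.mulVec f (X (s * M) ω)| + R * t) / K := fun ω => by
    have hint : ∀ g : S → ℝ, IntervalIntegrable (fun s => g (X (max s 0) ω)) volume 0 (t * M) :=
      fun g => hX.intervalIntegrable g ω _ _
    have e : ∫ s in (0 : ℝ)..t, Q.mulVec f (X (s * M) ω) =
        (∫ s in (0 : ℝ)..t, r (X (s * M) ω)) + K * ∫ s in (0 : ℝ)..t, h (X (s * M) ω) := by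
      rw [hscale, hscale, hscale]
      simp_rw [hQ]
      rw [intervalIntegral.integral_add (hint r) ((hint h).const_mul K),
        intervalIntegral.integral_const_mul]
      ring
    have e' : (∫ s in (0 : ℝ)..t, h (X (s * M) ω)) * K =
        (∫ s in (0 : ℝ)..t, Q.mulVec f (X (s * M) ω)) - ∫ s in (0 : ℝ)..t, r (X (s * M) ω) := by
      rw [e]
      ring
    have e'' := congrArg abs e'
    rw [abs_mul, abs_of_pos hK] at e''
    rw [le_div_iff₀ hK, e'']
    exact (abs_sub _ _).trans (add_le_add le_rfl (hbound _ _ hr ω))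
  have hia : ∀ (g : S → ℝ) (C : ℝ), (∀ x, |g x| ≤ C) →
      Integrable (fun ω => |∫ s in (0 : ℝ)..t, g (X (s * M) ω)|) P := fun g C hC =>
    Integrable.of_bound (hmeas g).abs.aestronglyMeasurable (C * t)
      (Eventually.of_forall fun ω => by simpa using hbound g C hC ω)
  refine (integral_mono (hia h H hh)
    (((hia _ _ hV).add (integrable_const (R * t))).div_const K) hpt).trans ?_
  rw [integral_div, integral_add' (hia _ _ hV) (integrable_const _)]
  simp only [integral_const, probReal_univ, one_smul]
  gcongr

/-! ### The generator on linear functions of the configuration. -/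

section Generator

/-- The linear function `η ↦ ∑ a(x) η(x)` of the configuration. -/
noncomputable def lin {α N : ℕ} (a : ℕ → ℝ) (η : Config α N) : ℝ :=
  ∑ x ∈ Finset.Icc 1 (N - 1), a x * occ η x

variable {α N : ℕ} (η : Config α N)

theorem occ_nonneg (x : ℕ) : 0 ≤ occ η x := by
  unfold occ
  split_ifs <;> positivity

theorem occ_le (x : ℕ) : occ η x ≤ α := by
  unfold occ
  split_ifs
  · exact_mod_cast Nat.lt_succ_iff.1 (Fin.is_lt _)
  · positivity

theorem occ_removeAt {x : ℕ} (h : occ η x ≠ 0) (z : ℕ) :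
    occ (removeAt η x) z = occ η z - if z = x then 1 else 0 := by
  unfold occ removeAt at *
  by_cases hzx : z = x
  · subst hzx
    by_cases hz : z ∈ Finset.Icc 1 (N - 1)
    · rw [dif_pos hz] at h
      simp only [dif_pos hz, if_true]
      rw [Nat.cast_sub (Nat.one_le_iff_ne_zero.2 fun h0 => h (by simp [h0]))]
      simp
    · exact absurd (dif_neg hz) h
  · simp [hzx]

theorem occ_addAt {x : ℕ} (hx : x ∈ Finset.Icc 1 (N - 1)) (h : occ η x ≠ α) (z : ℕ) :
    occ (addAt η x) z = occ η z + if z = x then 1 else 0 := by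
  unfold occ addAt at *
  by_cases hzx : z = x
  · subst hzx
    rw [dif_pos hx] at h
    have h1 : (η ⟨z, hx⟩ : ℕ) ≠ α := fun h0 => h (by rw [h0])
    have h2 := (η ⟨z, hx⟩).is_lt
    simp only [dif_pos hx, if_true]
    rw [min_eq_left (by omega)]
    push_cast
    ring
  · simp [hzx]

theorem lin_removeAt (a : ℕ → ℝ) {x : ℕ} (hx : x ∈ Finset.Icc 1 (N - 1)) (h : occ η x ≠ 0) :
    lin a (removeAt η x) = lin a η - a x := by
  simp only [lin, occ_removeAt η h, mul_sub, Finset.sum_sub_distrib]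
  simp [hx, -Finset.mem_Icc]

theorem lin_addAt (a : ℕ → ℝ) {x : ℕ} (hx : x ∈ Finset.Icc 1 (N - 1)) (h : occ η x ≠ α) :
    lin a (addAt η x) = lin a η + a x := by
  simp only [lin, occ_addAt η hx h, mul_add, Finset.sum_add_distrib]
  simp [hx, -Finset.mem_Icc]

/-- The rate vanishes exactly where truncation would falsify the increment of `lin a`: at an empty
`x` or a full `y`. -/
theorem bulkRate_mul_lin_move (a : ℕ → ℝ) {x y : ℕ} (hx : x ∈ Finset.Icc 1 (N - 1))
    (hy : y ∈ Finset.Icc 1 (N - 1)) (hxy : y ≠ x) :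
    bulkRate η x y * (lin a (move η x y) - lin a η) = bulkRate η x y * (a y - a x) := by
  unfold bulkRate
  by_cases h : occ η x = 0
  · simp [h]
  by_cases h' : occ η y = α
  · simp [h']
  have h'' : occ (removeAt η x) y ≠ α := by simpa [occ_removeAt η h, hxy] using h'
  rw [move, lin_addAt _ a hy h'', lin_removeAt η a hx h]
  ring

theorem occ_mul_lin_removeAt (a : ℕ → ℝ) {x : ℕ} (hx : x ∈ Finset.Icc 1 (N - 1)) :
    occ η x * (lin a (removeAt η x) - lin a η) = -(occ η x * a x) := by
  by_cases h : occ η x = 0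
  · simp [h]
  · rw [lin_removeAt η a hx h]
    ring

theorem sub_occ_mul_lin_addAt (a : ℕ → ℝ) {x : ℕ} (hx : x ∈ Finset.Icc 1 (N - 1)) :
    ((α : ℝ) - occ η x) * (lin a (addAt η x) - lin a η) = (α - occ η x) * a x := by
  by_cases h : occ η x = α
  · simp [h]
  · rw [lin_addAt η a hx h]
    ring

end Generator

theorem sum_Icc_sub_succ (F : ℕ → ℝ) (m : ℕ) :
    ∑ x ∈ Finset.Icc 1 m, (F x - F (x + 1)) = F 1 - F (m + 1) := by
  induction m with
  | zero => simp
  | succ m ih =>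
    rw [Finset.sum_Icc_succ_top (by omega), ih]
    ring

/-- The generator acts on linear functions with an affine profile through the currents at the
two ends. -/
theorem gen_lin (p : Params) {N : ℕ} (hN : 3 ≤ N) (a : ℕ → ℝ) (c : ℝ)
    (ha : ∀ x, a (x + 1) - a x = c) (η : Config p.α N) (h1 : p.ε + p.γ ≠ 0) (h2 : p.δ + p.β ≠ 0) :
    gen p N (lin a) η = c * p.α * (occ η 1 - occ η (N - 1))
      + 1 / (N : ℝ) ^ p.θ * (p.ε + p.γ) * a 1 * (rhoLeft p - occ η 1)
      + 1 / (N : ℝ) ^ p.θ * (p.δ + p.β) * a (N - 1) * (rhoRight p - occ η (N - 1)) := by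
  have m1 : 1 ∈ Finset.Icc 1 (N - 1) := Finset.mem_Icc.2 ⟨le_rfl, by omega⟩
  have mN : N - 1 ∈ Finset.Icc 1 (N - 1) := Finset.mem_Icc.2 ⟨by omega, le_rfl⟩
  have hb : genBulk p (lin a) η = c * p.α * (occ η 1 - occ η (N - 1)) := by
    have e : N - 1 = (N - 2) + 1 := by omega
    rw [genBulk, e, ← sum_Icc_sub_succ (occ η), Finset.mul_sum]
    refine Finset.sum_congr rfl fun x hx => ?_
    rw [Finset.mem_Icc] at hx
    have hx0 : x ∈ Finset.Icc 1 (N - 1) := Finset.mem_Icc.2 ⟨hx.1, by omega⟩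
    have hx1 : x + 1 ∈ Finset.Icc 1 (N - 1) := Finset.mem_Icc.2 ⟨by omega, by omega⟩
    -- Gradient property: the quadratic terms of the two opposite rates cancel, leaving `α (η(x) -
    -- η(x + 1))`.
    rw [bulkRate_mul_lin_move η a hx0 hx1 (by omega), bulkRate_mul_lin_move η a hx1 hx0 (by omega),
      ← neg_sub (a (x + 1)) (a x), ha, bulkRate, bulkRate]
    ring
  have hl : genLeft p (lin a) η =
      1 / (N : ℝ) ^ p.θ * (p.ε + p.γ) * a 1 * (rhoLeft p - occ η 1) := by
    have e1 := occ_mul_lin_removeAt η a m1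
    have e2 := sub_occ_mul_lin_addAt η a m1
    have e3 : (p.ε + p.γ) * rhoLeft p = p.α * p.ε := by
      unfold rhoLeft
      field_simp
    rw [genLeft]
    linear_combination (1 / (N : ℝ) ^ p.θ * p.γ) * e1 + (1 / (N : ℝ) ^ p.θ * p.ε) * e2
      - 1 / (N : ℝ) ^ p.θ * a 1 * e3
  have hr : genRight p (lin a) η =
      1 / (N : ℝ) ^ p.θ * (p.δ + p.β) * a (N - 1) * (rhoRight p - occ η (N - 1)) := by
    have e1 := occ_mul_lin_removeAt η a mN
    have e2 := sub_occ_mul_lin_addAt η a mN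
    have e3 : (p.δ + p.β) * rhoRight p = p.α * p.δ := by
      unfold rhoRight
      field_simp
    rw [genRight]
    linear_combination (1 / (N : ℝ) ^ p.θ * p.β) * e1 + (1 / (N : ℝ) ^ p.θ * p.δ) * e2
      - 1 / (N : ℝ) ^ p.θ * a (N - 1) * e3
  rw [gen, hl, hb, hr]
  ring

/-! ### Orders of magnitude and the limit. -/

theorem abs_lin_le {α N : ℕ} (a : ℕ → ℝ) (ha : ∀ x ∈ Finset.Icc 1 (N - 1), |a x| ≤ N)
    (η : Config α N) : |lin a η| ≤ α * (N : ℝ) ^ 2 := by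
  refine (Finset.abs_sum_le_sum_abs _ _).trans ?_
  have : ∀ x ∈ Finset.Icc 1 (N - 1), |a x * occ η x| ≤ N * α := fun x hx => by
    rw [abs_mul, abs_of_nonneg (occ_nonneg η x)]
    exact mul_le_mul (ha x hx) (occ_le η x) (occ_nonneg η x) (by positivity)
  refine (Finset.sum_le_card_nsmul _ _ _ this).trans ?_
  rw [nsmul_eq_mul, Nat.card_Icc, Nat.add_sub_cancel]
  have h : ((N - 1 : ℕ) : ℝ) ≤ N := by exact_mod_cast Nat.sub_le N 1
  calc ((N - 1 : ℕ) : ℝ) * (N * α) ≤ N * (N * α) := by gcongr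
    _ = α * (N : ℝ) ^ 2 := by ring

theorem mul_div_mem_Icc {a x y : ℝ} (ha : 0 ≤ a) (hx : 0 < x) (hy : 0 < y) :
    a * (x / (x + y)) ∈ Set.Icc 0 a := by
  have : x / (x + y) ≤ 1 := (div_le_one (by positivity)).2 (by linarith)
  exact ⟨by positivity, mul_le_of_le_one_right ha this⟩

theorem tendsto_boundary_rate {θ c : ℝ} (hθ : θ < 1) (hc : 0 < c) :
    Tendsto (fun N : ℕ => 1 / (N : ℝ) ^ θ * c * ((N : ℝ) - 2)) atTop atTop := by
  have h1 : Tendsto (fun N : ℕ => c / 3 * (N : ℝ) ^ (1 - θ)) atTop atTop :=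
    ((tendsto_rpow_atTop (by linarith)).comp tendsto_natCast_atTop_atTop).const_mul_atTop
      (by positivity)
  refine tendsto_atTop_mono' _ ?_ h1
  filter_upwards [eventually_ge_atTop 3] with N hN
  have hN' : (3 : ℝ) ≤ N := by exact_mod_cast hN
  have hN0 : (0 : ℝ) < N := by linarith
  rw [Real.rpow_sub hN0, Real.rpow_one]
  have hp := Real.rpow_pos_of_pos hN0 θ
  -- The constant 3 comes from `N - 2 ≥ N / 3`, valid for `N ≥ 3`.
  calc c / 3 * (N / (N : ℝ) ^ θ) = 1 / (N : ℝ) ^ θ * c * (N / 3) := by ring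
    _ ≤ _ := by
      gcongr
      linarith

theorem tendsto_error {K : ℕ → ℝ} (hK : Tendsto K atTop atTop) (A B C D E : ℝ) :
    Tendsto (fun N => (√(A * (B + K N * C) * E) + D) / K N) atTop (𝓝 0) := by
  have hi : Tendsto (fun N => (K N)⁻¹) atTop (𝓝 0) := tendsto_inv_atTop_zero.comp hK
  have h1 : Tendsto (fun N => √(A * (B * (K N)⁻¹ + C) * E * (K N)⁻¹) + D * (K N)⁻¹) atTop (𝓝 0) := by
    have := ((((((hi.const_mul B).add_const C).const_mul A).mul_const E).mul hi).sqrt).add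
      (hi.const_mul D)
    simpa using this
  refine h1.congr' ?_
  filter_upwards [hK.eventually_gt_atTop 0] with N hN
  have e : A * (B * (K N)⁻¹ + C) * E * (K N)⁻¹ = A * (B + K N * C) * E / K N ^ 2 := by
    field_simp
  rw [e, Real.sqrt_div' _ (sq_nonneg _), Real.sqrt_sq hN.le]
  ring

/-- The estimate common to both reservoirs. -/
theorem tendsto_integral_abs_boundary (p : Params) (hθ : p.θ < 1) {Ω : ℕ → Type*}
    [∀ N, MeasurableSpace (Ω N)] (P : ∀ N, Measure (Ω N)) [∀ N, IsProbabilityMeasure (P N)]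
    (μ : ∀ N, PMF (Config p.α N)) (η : ∀ N, ℝ → Ω N → Config p.α N)
    (hη : ∀ N, IsMarkovChain (P N) (genMatrix p N) (μ N) (η N)) {t : ℝ} (ht : 0 ≤ t)
    {κ σ ρ : ℝ} (hκ : 0 < κ) (hσ : |σ| = 1) (hρ : ρ ∈ Set.Icc (0 : ℝ) p.α) (b : ℕ → ℕ)
    (a : ℕ → ℕ → ℝ) (ha : ∀ N, ∀ x ∈ Finset.Icc 1 (N - 1), |a N x| ≤ N)
    (hgen : ∀ N ≥ 3, ∀ ξ : Config p.α N, gen p N (lin (a N)) ξ =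
      σ * p.α * (occ ξ 1 - occ ξ (N - 1))
        + 1 / (N : ℝ) ^ p.θ * κ * ((N : ℝ) - 2) * (ρ - occ ξ (b N))) :
    Tendsto (fun N : ℕ => ∫ ω,
      |∫ s in (0 : ℝ)..t, (ρ - occ (η N (s * (N : ℝ) ^ 2) ω) (b N))| ∂(P N)) atTop (𝓝 0) := by
  have hK := tendsto_boundary_rate hθ hκ
  have habs : ∀ {x y : ℝ}, x ∈ Set.Icc (0 : ℝ) p.α → y ∈ Set.Icc (0 : ℝ) p.α → |x - y| ≤ p.α :=
    fun hx hy => abs_le.2 ⟨by linarith [hx.1, hy.2], by linarith [hx.2, hy.1]⟩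
  have hocc : ∀ {N : ℕ} (ξ : Config p.α N) x, occ ξ x ∈ Set.Icc (0 : ℝ) p.α := fun ξ x =>
    ⟨occ_nonneg ξ x, occ_le ξ x⟩
  refine squeeze_zero' (Eventually.of_forall fun N => integral_nonneg fun ω => abs_nonneg _) ?_
    (tendsto_error hK (4 * t) ((p.α : ℝ) * p.α) p.α ((p.α : ℝ) * p.α * t) p.α)
  filter_upwards [hK.eventually_gt_atTop 0, eventually_ge_atTop 3] with N hKN hN
  have hN0 : (0 : ℝ) < (N : ℝ) ^ 2 := by positivity
  have h := (hη N).integral_abs_integral_le (f := lin (a N))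
    (r := fun ξ => σ * p.α * (occ ξ 1 - occ ξ (N - 1))) (h := fun ξ => ρ - occ ξ (b N))
    (R := (p.α : ℝ) * p.α) (H := p.α) (F := p.α * (N : ℝ) ^ 2) hKN hN0 ht
    (fun ξ => by rw [genMatrix_mulVec, hgen N hN])
    (fun ξ => by
      rw [abs_mul, abs_mul, hσ, one_mul, Nat.abs_cast]
      exact mul_le_mul_of_nonneg_left (habs (hocc _ _) (hocc _ _)) (Nat.cast_nonneg _))
    (fun ξ => habs hρ (hocc _ _)) (abs_lin_le (a N) (ha N))
  -- The size `N ^ 2` of the test function cancels against the speed of the chain.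
  rwa [mul_div_cancel_right₀ _ hN0.ne'] at h

end SEP

theorem mainTheorem3 (p : SEP.Params) (hα : 1 ≤ p.α)
    (hε : 0 < p.ε) (hγ : 0 < p.γ) (hβ : 0 < p.β) (hδ : 0 < p.δ) (hθ : p.θ < 1)
    {Ω : ℕ → Type*} [∀ N, MeasurableSpace (Ω N)]
    (P : ∀ N, Measure (Ω N)) [∀ N, IsProbabilityMeasure (P N)]
    (μ : ∀ N, PMF (SEP.Config p.α N))
    (η : ∀ N, ℝ → Ω N → SEP.Config p.α N)
    (hη : ∀ N, SEP.IsMarkovChain (P N) (SEP.genMatrix p N) (μ N) (η N))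
    (T : ℝ) (hT : 0 < T) (t : ℝ) (ht : t ∈ Set.Icc 0 T) :
    Tendsto (fun N : ℕ => ∫ ω,
        |∫ s in (0 : ℝ)..t, (SEP.rhoLeft p - SEP.occ (η N (s * (N : ℝ) ^ 2) ω) 1)| ∂(P N))
      atTop (𝓝 0) ∧
    Tendsto (fun N : ℕ => ∫ ω,
        |∫ s in (0 : ℝ)..t, (SEP.rhoRight p - SEP.occ (η N (s * (N : ℝ) ^ 2) ω) (N - 1))| ∂(P N))
      atTop (𝓝 0) := by
  have hx : ∀ {N x : ℕ}, x ∈ Finset.Icc 1 (N - 1) → (1 : ℝ) ≤ x ∧ (x : ℝ) + 1 ≤ N := by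
    intro N x hx
    rw [Finset.mem_Icc] at hx
    exact ⟨by exact_mod_cast hx.1, by exact_mod_cast (by omega : x + 1 ≤ N)⟩
  have hN1 : ∀ {N : ℕ}, 3 ≤ N → ((N - 1 : ℕ) : ℝ) = N - 1 := fun hN => by
    rw [Nat.cast_sub (by omega), Nat.cast_one]
  constructor
  · refine SEP.tendsto_integral_abs_boundary p hθ P μ η hη ht.1 (add_pos hε hγ)
      (σ := -1) (by simp) (SEP.mul_div_mem_Icc (Nat.cast_nonneg _) hε hγ) (fun _ => 1)
      (fun N x => (N : ℝ) - 1 - x) (fun N x h => ?_) (fun N hN ξ => ?_)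
    · obtain ⟨h1, h2⟩ := hx h
      exact abs_le.2 ⟨by linarith, by linarith⟩
    · rw [SEP.gen_lin p hN _ (-1) (fun x => by push_cast; ring) ξ (by positivity) (by positivity),
        hN1 hN, SEP.rhoLeft]
      push_cast
      ring
  · refine SEP.tendsto_integral_abs_boundary p hθ P μ η hη ht.1 (add_pos hδ hβ)
      (σ := 1) (by simp) (SEP.mul_div_mem_Icc (Nat.cast_nonneg _) hδ hβ) (fun N => N - 1)
      (fun N x => (x : ℝ) - 1) (fun N x h => ?_) (fun N hN ξ => ?_)
    · obtain ⟨h1, h2⟩ := hx h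
      exact abs_le.2 ⟨by linarith, by linarith⟩
    · rw [SEP.gen_lin p hN _ 1 (fun x => by push_cast; ring) ξ (by positivity) (by positivity),
        hN1 hN, SEP.rhoRight]
      push_cast
      ring
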